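/- Let $X$ be a set. A complete mistake tree of depth $n$ is a complete binary tree of depth $n$ whose internal nodes are labelled by elements of $X$; a root-to-leaf path in it gives a sequence of examples $(x_1,y_1),\dots,(x_n,y_n)$, where $x_i$ is the label of the $i$-th internal node on the path and $y_i=1$ if the path continues to the right child of that node and $y_i=0$ otherwise. The tree is shattered by a class $\mathcal H\subseteq\{0,1\}^X$ if for every root-to-leaf path there is $h\in\mathcal H$ with $h(x_i)=y_i$ for all $i\le n$. The Littlestone dimension $\mathrm{Ldim}(\mathcal H)$ is the largest depth of a complete mistake tree shattered by $\mathcal H$ ($\infty$ if there is no largest depth, $-\infty$ if $\mathcal H=\emptyset$). For $G:\{0,1\}^k\to\{0,1\}$ and $\mathcal H_1,\dots,\mathcal H_k\subseteq\{0,1\}^X$ put \[ G(\mathcal H_1,\dots,\mathcal H_k)=\{x\mapsto G(h_1(x),\dots,h_k(x)) : h_i\in\mathcal H_i \text{ for } i\le k\}. \] Theorem (A Closure Theorem for the Littlestone Dimension). There are universal constants $C>0$ and $c\in\mathbb N$ such that the following holds for every set $X$, all $k,d\in\mathbb N$, and all classes $\mathcal H_1,\dots,\mathcal H_k\subseteq\{0,1\}^X$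 with $\mathrm{Ldim}(\mathcal H_i)\le d$ for every $i\le k$. 1. For every Boolean function $G:\{0,1\}^k\to\{0,1\}$, \[ \mathrm{Ldim}\bigl(G(\mathcal H_1,\dots,\mathcal H_k)\bigr)\le C\cdot 2^{2k}k^2 d\cdot\log^c(k+2)\,\log^c(d+2), \] that is, $\mathrm{Ldim}(G(\mathcal H_1,\dots,\mathcal H_k))\le\tilde O(2^{2k}k^2d)$, where $\tilde O$ conceals polynomial factors in $\log k$ and $\log d$. 2. If $G$ is the $k$-wise majority-vote (with value $1$ if and only if more than half of its $k$ inputs are $1$), the $k$-wise AND, or the $k$-wise OR, then \[ \mathrm{Ldim}\bigl(G(\mathcal H_1,\dots,\mathcal H_k)\bigr)\le C\cdot k^2 d\cdot\log^c(k+2)\,\log^c(d+2), \] that is, $\mathrm{Ldim}(G(\mathcal H_1,\dots,\mathcal H_k))\le\tilde O(k^2d)$. -/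

import Mathlib

namespace Littlestone

universe u

/-- A complete binary tree of depth `n` whose internal nodes are labelled by elements of `X`
(a complete mistake tree); `node x l r` has left child `l` and right child `r`. -/
inductive MistakeTree (X : Type u) : ℕ → Type u
  | leaf : MistakeTree X 0
  | node {n : ℕ} (x : X) (l r : MistakeTree X n) : MistakeTree X (n + 1)

/-- The sequence of examples `(x₁, y₁), …, (xₙ, yₙ)` along the root-to-leaf path with turns
`y : Fin n → Bool`, where `true` means "go to the right child". -/
def MistakeTree.path {X : Type u} : {n : ℕ} → MistakeTree X n → (Fin n → Bool) → List (X × Bool)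
  | _, .leaf, _ => []
  | _, .node x l r, y =>
      (x, y 0) :: (if y 0 = true then r.path (fun i => y i.succ) else l.path (fun i => y i.succ))

/-- A tree is shattered by `H` if the examples on each root-to-leaf path are
realized by some `h ∈ H`. -/
def Shatters {X : Type u} (H : Set (X → Bool)) {n : ℕ} (T : MistakeTree X n) : Prop :=
  ∀ y : Fin n → Bool, ∃ h ∈ H, ∀ e ∈ T.path y, h e.1 = e.2

/-- The Littlestone dimension: the largest depth of a complete tree shattered by `H`. It is `⊤` if
the depths are unbounded, and `⊥` if no tree is shattered (that is, if `H` is empty). -/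
noncomputable def ldim {X : Type u} (H : Set (X → Bool)) : WithBot ℕ∞ :=
  ⨆ n ∈ {n : ℕ | ∃ T : MistakeTree X n, Shatters H T}, (n : WithBot ℕ∞)

/-- The composed class `G(H₁, …, H_k) = {G(h₁, …, h_k) : hᵢ ∈ Hᵢ}`. -/
def compose {X : Type u} {k : ℕ} (G : (Fin k → Bool) → Bool) (H : Fin k → Set (X → Bool)) :
    Set (X → Bool) :=
  {f | ∃ h : Fin k → X → Bool, (∀ i, h i ∈ H i) ∧ f = fun x => G (fun i => h i x)}

/-- Majority-vote of `k` bits: `true` iff more than half of the bits are `true`. -/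
def maj (k : ℕ) (b : Fin k → Bool) : Bool :=
  decide (k < 2 * (Finset.univ.filter (fun i => b i = true)).card)

/-- The `k`-wise AND. -/
def andAll (k : ℕ) (b : Fin k → Bool) : Bool := decide (∀ i, b i = true)

/-- The `k`-wise OR. -/
def orAny (k : ℕ) (b : Fin k → Bool) : Bool := decide (∃ i, b i = true)

end Littlestone

namespace Littlestone

open Finset

universe u

variable {X : Type u}

/-! Sauer–Shelah counting along trees. In a depth-`n` tree, a class of Littlestone dimension at most
`d` realizes at most `(n + 1) ^ d` paths, and for a composition these counts multiply, whatever `G`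
is (`card_realizedPaths_compose_le`). A shattered tree has all `2 ^ n` paths realized, so `2 ^ n ≤
(n + 1) ^ (k * d)`, which forces `n = O(k d log k log d)` when `k, d ≥ 1`, below both claimed
bounds. -/

/-- The members of `H` with value `b` at `x`. -/
def restrict (H : Set (X → Bool)) (x : X) (b : Bool) : Set (X → Bool) := {h | h ∈ H ∧ h x = b}

/-- No tree of depth `m` is shattered by `H`, that is, the Littlestone dimension is below `m`. -/
def ShattersNone (H : Set (X → Bool)) (m : ℕ) : Prop := ∀ T : MistakeTree X m, ¬ Shatters H T

theorem Shatters.mono {H H' : Set (X → Bool)} (hH : H ⊆ H') {n : ℕ} {T : MistakeTree X n}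
    (hT : Shatters H T) : Shatters H' T := fun y =>
  let ⟨h, hh, he⟩ := hT y
  ⟨h, hH hh, he⟩

theorem Shatters.node {H : Set (X → Bool)} {x : X} {n : ℕ} {l r : MistakeTree X n}
    (hl : Shatters (restrict H x false) l) (hr : Shatters (restrict H x true) r) :
    Shatters H (.node x l r) := by
  intro y
  cases hy : y 0 with
  | false =>
    obtain ⟨h, ⟨hH, hx⟩, he⟩ := hl fun i => y i.succ
    refine ⟨h, hH, ?_⟩
    simpa [MistakeTree.path, hy, hx] using he
  | true =>
    obtain ⟨h, ⟨hH, hx⟩, he⟩ := hr fun i => y i.succ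
    refine ⟨h, hH, ?_⟩
    simpa [MistakeTree.path, hy, hx] using he

theorem ShattersNone.mono {H H' : Set (X → Bool)} (hH : H ⊆ H') {m : ℕ}
    (h : ShattersNone H' m) : ShattersNone H m := fun T hT => h T (hT.mono hH)

theorem ShattersNone.restrict {H : Set (X → Bool)} {m : ℕ} (h : ShattersNone H m) (x : X)
    (b : Bool) : ShattersNone (restrict H x b) m := h.mono fun _ hf => hf.1

theorem ShattersNone.eq_empty {H : Set (X → Bool)} (h : ShattersNone H 0) : H = ∅ := by
  refine Set.eq_empty_of_forall_notMem fun f hf => h .leaf fun y => ⟨f, hf, ?_⟩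
  simp [MistakeTree.path]

theorem ShattersNone.restrict_false_or_true {H : Set (X → Bool)} {m : ℕ}
    (h : ShattersNone H (m + 1)) (x : X) :
    ShattersNone (Littlestone.restrict H x false) m ∨
      ShattersNone (Littlestone.restrict H x true) m := by
  by_contra! hc
  simp only [ShattersNone, not_forall, not_not] at hc
  obtain ⟨⟨l, hl⟩, r, hr⟩ := hc
  exact h _ (hl.node hr)

/-- A bound for `∑ j < m, n.choose j`, the number of paths of a tree of depth `n` realized by a
class of Littlestone dimension below `m`. -/
def growthBound (n : ℕ) : ℕ → ℕ
  | 0 => 0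
  | m + 1 => (n + 1) ^ m

/-- An inequality form of Pascal's rule. -/
theorem growthBound_add_le (n m : ℕ) :
    growthBound n m + growthBound n (m + 1) ≤ growthBound (n + 1) (m + 1) := by
  cases m with
  | zero => simp [growthBound]
  | succ m =>
    calc (n + 1) ^ m + (n + 1) ^ (m + 1) = (n + 1) ^ m * (n + 2) := by ring
      _ ≤ (n + 2) ^ m * (n + 2) := by gcongr; omega
      _ = (n + 1 + 1) ^ (m + 1) := by ring

/-- At each `x` one of the two restrictions loses a dimension, so the bounds obey Pascal's rule. -/
theorem ShattersNone.exists_restrict_bounds {H : Set (X → Bool)} {m : ℕ} (h : ShattersNone H m)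
    (x : X) (n : ℕ) :
    ∃ m' : Bool → ℕ, (∀ b, ShattersNone (Littlestone.restrict H x b) (m' b)) ∧
      ∑ b, growthBound n (m' b) ≤ growthBound (n + 1) m := by
  cases m with
  | zero => exact ⟨fun _ => 0, fun b => h.restrict x b, by simp [growthBound]⟩
  | succ m =>
    have key := growthBound_add_le n m
    rcases h.restrict_false_or_true x with h' | h'
    · refine ⟨fun b => if b then m + 1 else m, ?_, ?_⟩
      · rintro (_ | _)
        · exact h'
        · exact h.restrict x true
      · simpa [add_comm] using key
    · refine ⟨fun b => if b then m else m + 1, ?_, ?_⟩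
      · rintro (_ | _)
        · exact h.restrict x false
        · exact h'
      · simpa using key

open Classical in
/-- The root-to-leaf paths of `T` whose examples are realized by `H`. -/
noncomputable def realizedPaths (H : Set (X → Bool)) {n : ℕ} (T : MistakeTree X n) :
    Finset (Fin n → Bool) :=
  {y | ∃ h ∈ H, ∀ e ∈ T.path y, h e.1 = e.2}

theorem Shatters.card_realizedPaths {H : Set (X → Bool)} {n : ℕ} {T : MistakeTree X n}
    (hT : Shatters H T) : #(realizedPaths H T) = 2 ^ n := by
  have : realizedPaths H T = univ := by
    ext y
    simpa [realizedPaths] using hT y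
  simp [this]

/-- The values `b` of the `hᵢ` at the root determine the turn `G b`, so each `b` contributes paths
through only one subtree. -/
theorem realizedPaths_compose_node_subset {k : ℕ} (G : (Fin k → Bool) → Bool)
    (H : Fin k → Set (X → Bool)) (x : X) {n : ℕ} (l r : MistakeTree X n) :
    realizedPaths (compose G H) (.node x l r) ⊆
      univ.biUnion fun b : Fin k → Bool =>
        (realizedPaths (compose G fun i => restrict (H i) x (b i))
          (if G b = true then r else l)).image (Fin.cons (α := fun _ => Bool) (G b)) := by
  intro y hy
  simp only [realizedPaths, mem_filter, mem_univ, true_and] at hy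
  obtain ⟨_, ⟨h, hH, rfl⟩, he⟩ := hy
  simp only [MistakeTree.path, List.mem_cons, forall_eq_or_imp] at he
  obtain ⟨h0, hs⟩ := he
  simp only [mem_biUnion, mem_univ, true_and, mem_image, realizedPaths, mem_filter]
  refine ⟨fun i => h i x, fun i => y i.succ,
    ⟨_, ⟨h, fun i => ⟨hH i, rfl⟩, rfl⟩, ?_⟩, ?_⟩
  · rw [h0]
    split_ifs at hs ⊢ <;> exact hs
  · rw [h0]
    exact Fin.cons_self_tail y

/-- A Sauer–Shelah type bound for compositions, along mistake trees. -/
theorem card_realizedPaths_compose_le {k : ℕ} (G : (Fin k → Bool) → Bool) {n : ℕ}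
    (T : MistakeTree X n) : ∀ (H : Fin k → Set (X → Bool)) (m : Fin k → ℕ),
      (∀ i, ShattersNone (H i) (m i)) →
        #(realizedPaths (compose G H) T) ≤ ∏ i, growthBound n (m i) := by
  induction T with
  | leaf =>
    intro H m hm
    -- A zero factor makes the bound `0`; then some `H i` is empty, and so is the composition.
    by_cases h0 : ∃ i, m i = 0
    · obtain ⟨i, hi⟩ := h0
      have hempty : H i = ∅ := (hi ▸ hm i).eq_empty
      have : realizedPaths (compose G H) .leaf = ∅ := by
        refine Finset.eq_empty_of_forall_notMem fun y hy => ?_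
        simp only [realizedPaths, mem_filter] at hy
        obtain ⟨-, _, ⟨h, hH, -⟩, -⟩ := hy
        simpa [hempty] using hH i
      simp [this]
    · push Not at h0
      have : ∀ i, growthBound 0 (m i) = 1 := fun i => by
        obtain ⟨j, hj⟩ := Nat.exists_eq_succ_of_ne_zero (h0 i)
        simp [hj, growthBound]
      simpa [this] using card_le_univ (realizedPaths (compose G H) .leaf)
  | @node n x l r ihl ihr =>
    intro H m hm
    choose m' hm' hle using fun i => (hm i).exists_restrict_bounds x n
    calc #(realizedPaths (compose G H) (.node x l r))
        ≤ ∑ b : Fin k → Bool, #(realizedPaths (compose G fun i => restrict (H i) x (b i))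
            (if G b = true then r else l)) :=
          (card_le_card (realizedPaths_compose_node_subset G H x l r)).trans <|
            card_biUnion_le.trans <| sum_le_sum fun _ _ => card_image_le
      _ ≤ ∑ b : Fin k → Bool, ∏ i, growthBound n (m' i (b i)) := by
          refine sum_le_sum fun b _ => ?_
          split_ifs
          · exact ihr _ _ fun i => hm' i (b i)
          · exact ihl _ _ fun i => hm' i (b i)
      -- Distributivity turns the sum over all `b` into independent recursions, one for each class.
      _ = ∏ i, ∑ b, growthBound n (m' i b) := by
          rw [prod_univ_sum, Fintype.piFinset_univ]
      _ ≤ ∏ i, growthBound (n + 1) (m i) := prod_le_prod' fun i _ => hle i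

theorem le_ldim {H : Set (X → Bool)} {n : ℕ} {T : MistakeTree X n} (hT : Shatters H T) :
    (n : WithBot ℕ∞) ≤ ldim H :=
  le_iSup₂_of_le (f := fun (n : ℕ) (_ : n ∈ {n : ℕ | ∃ T : MistakeTree X n, Shatters H T}) =>
    (n : WithBot ℕ∞)) n ⟨T, hT⟩ le_rfl

theorem shattersNone_of_ldim_le {H : Set (X → Bool)} {d : ℕ}
    (h : ldim H ≤ (d : WithBot ℕ∞)) : ShattersNone H (d + 1) := fun _ hT => by
  have := (le_ldim hT).trans h
  have : d + 1 ≤ d := by exact_mod_cast this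
  omega

theorem two_pow_le_of_shatters_compose {k d n : ℕ} (G : (Fin k → Bool) → Bool)
    {H : Fin k → Set (X → Bool)} (hH : ∀ i, ldim (H i) ≤ (d : WithBot ℕ∞))
    {T : MistakeTree X n} (hT : Shatters (compose G H) T) : 2 ^ n ≤ (n + 1) ^ (k * d) := by
  have := card_realizedPaths_compose_le G T H (fun _ => d + 1)
    fun i => shattersNone_of_ldim_le (hH i)
  rw [hT.card_realizedPaths] at this
  simpa [growthBound, ← pow_mul, mul_comm] using this

theorem one_le_log_natCast_add_two {n : ℕ} (hn : n ≠ 0) : 1 ≤ Real.log ((n : ℝ) + 2) := by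
  rw [Real.le_log_iff_exp_le (by positivity)]
  have : (1 : ℝ) ≤ n := by exact_mod_cast Nat.one_le_iff_ne_zero.mpr hn
  linarith [Real.exp_one_lt_d9]

theorem le_of_two_pow_le {k d n : ℕ} (h : 2 ^ n ≤ (n + 1) ^ (k * d)) :
    (n : ℝ) ≤ 12 * (k * d) * (Real.log ((k : ℝ) + 2) * Real.log ((d : ℝ) + 2)) := by
  by_cases h0 : k * d = 0
  · have h0' : (k : ℝ) * d = 0 := by exact_mod_cast h0
    rw [h0, pow_zero] at h
    have : n = 0 := by
      by_contra hn
      exact absurd h (not_le.mpr (Nat.one_lt_two_pow hn))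
    simp [this, h0']
  obtain ⟨hk, hd⟩ := mul_ne_zero_iff.mp h0
  have hk1 : (1 : ℝ) ≤ k := by exact_mod_cast Nat.one_le_iff_ne_zero.mpr hk
  have hd1 : (1 : ℝ) ≤ d := by exact_mod_cast Nat.one_le_iff_ne_zero.mpr hd
  have hK := one_le_log_natCast_add_two hk
  have hL := one_le_log_natCast_add_two hd
  set K := Real.log ((k : ℝ) + 2) with hKdef
  set L := Real.log ((d : ℝ) + 2) with hLdef
  obtain ⟨a, ha⟩ : ∃ a : ℝ, a = k * d := ⟨_, rfl⟩
  have ha1 : 1 ≤ a := ha ▸ one_le_mul_of_one_le_of_one_le hk1 hd1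
  have hlog : n * Real.log 2 ≤ a * Real.log (n + 1) := by
    have h' : (2 : ℝ) ^ n ≤ ((n : ℝ) + 1) ^ (k * d) := by exact_mod_cast h
    have := Real.log_le_log (by positivity) h'
    rw [Real.log_pow, Real.log_pow] at this
    rw [ha]
    exact_mod_cast this
  -- The tangent to `log` at `4 * a`: multiplied by `a`, its slope becomes `1 / 4`, less than `log
  -- 2`.
  have htangent : Real.log (n + 1) ≤ (n + 1) / (4 * a) - 1 + Real.log (4 * a) := by
    have := Real.log_le_sub_one_of_pos (x := ((n : ℝ) + 1) / (4 * a)) (by positivity)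
    rw [Real.log_div (by positivity) (by positivity)] at this
    linarith
  have hlog4a : Real.log (4 * a) ≤ 4 * (K * L) := by
    calc Real.log (4 * a) ≤ Real.log (((k : ℝ) + 2) ^ 2 * ((d : ℝ) + 2) ^ 2) := by
          refine Real.log_le_log (by positivity) ?_
          rw [ha]
          have h1 : 2 * (k : ℝ) ≤ ((k : ℝ) + 2) ^ 2 := by nlinarith
          have h2 : 2 * (d : ℝ) ≤ ((d : ℝ) + 2) ^ 2 := by nlinarith
          calc 4 * ((k : ℝ) * d) = (2 * k) * (2 * d) := by ring
            _ ≤ _ := by gcongr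
      _ = 2 * K + 2 * L := by
          rw [Real.log_mul (by positivity) (by positivity), Real.log_pow, Real.log_pow]
          norm_num [hKdef, hLdef]
      _ ≤ 4 * (K * L) := by nlinarith
  have hmul : a * Real.log (n + 1) ≤ (n + 1) / 4 - a + a * (4 * (K * L)) := by
    calc a * Real.log (n + 1) ≤ a * ((n + 1) / (4 * a) - 1 + 4 * (K * L)) := by
          gcongr
          linarith
      _ = _ := by field_simp
  have h2 := Real.log_two_gt_d9
  have hn0 : (0 : ℝ) ≤ n := n.cast_nonneg
  have hP : 0 ≤ a * (K * L) := by positivity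
  rw [← ha]
  -- As `log 2 - 1 / 4 > 1 / 3` and `a ≥ 1`, what remains is `n / 3 ≤ 4 * a * (K * L)`, whence the
  -- `12`.
  nlinarith

theorem exists_ldim_compose_le {k d : ℕ} (G : (Fin k → Bool) → Bool)
    {H : Fin k → Set (X → Bool)} (hH : ∀ i, ldim (H i) ≤ (d : WithBot ℕ∞)) :
    ∃ D : ℕ, ldim (compose G H) ≤ (D : WithBot ℕ∞) ∧
      (D : ℝ) ≤ 12 * (k * d) * (Real.log ((k : ℝ) + 2) * Real.log ((d : ℝ) + 2)) := by
  have hK : 0 ≤ Real.log ((k : ℝ) + 2) := Real.log_nonneg (by linarith [k.cast_nonneg (α := ℝ)])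
  have hL : 0 ≤ Real.log ((d : ℝ) + 2) := Real.log_nonneg (by linarith [d.cast_nonneg (α := ℝ)])
  refine ⟨⌊12 * (k * d) * (Real.log ((k : ℝ) + 2) * Real.log ((d : ℝ) + 2))⌋₊,
    iSup₂_le ?_, Nat.floor_le (by positivity)⟩
  rintro n ⟨T, hT⟩
  exact_mod_cast Nat.le_floor (le_of_two_pow_le (two_pow_le_of_shatters_compose G hH hT))

end Littlestone

theorem theorem1 :
    ∃ (C : ℝ) (c : ℕ), 0 < C ∧
      ∀ (X : Type*) (k d : ℕ) (H : Fin k → Set (X → Bool)),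
        (∀ i, Littlestone.ldim (H i) ≤ (d : WithBot ℕ∞)) →
          (∀ G : (Fin k → Bool) → Bool,
            ∃ D : ℕ, Littlestone.ldim (Littlestone.compose G H) ≤ (D : WithBot ℕ∞) ∧
              (D : ℝ) ≤ C * (2 ^ (2 * k) * (k : ℝ) ^ 2 * (d : ℝ)) *
                (Real.log ((k : ℝ) + 2) ^ c * Real.log ((d : ℝ) + 2) ^ c)) ∧
          (∀ G : (Fin k → Bool) → Bool,
            G = Littlestone.maj k ∨ G = Littlestone.andAll k ∨ G = Littlestone.orAny k →
              ∃ D : ℕ, Littlestone.ldim (Littlestone.compose G H) ≤ (D : WithBot ℕ∞) ∧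
                (D : ℝ) ≤ C * ((k : ℝ) ^ 2 * (d : ℝ)) *
                  (Real.log ((k : ℝ) + 2) ^ c * Real.log ((d : ℝ) + 2) ^ c)) := by
  refine ⟨12, 1, by norm_num, fun X k d H hH => ?_⟩
  have hK : 0 ≤ Real.log ((k : ℝ) + 2) := Real.log_nonneg (by linarith [k.cast_nonneg (α := ℝ)])
  have hL : 0 ≤ Real.log ((d : ℝ) + 2) := Real.log_nonneg (by linarith [d.cast_nonneg (α := ℝ)])
  have hk : (k : ℝ) ≤ (k : ℝ) ^ 2 := by exact_mod_cast Nat.le_self_pow two_ne_zero k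
  have hpow : (1 : ℝ) ≤ 2 ^ (2 * k) := one_le_pow₀ one_le_two
  simp only [pow_one]
  refine ⟨fun G => ?_, fun G _ => ?_⟩ <;>
    obtain ⟨D, hD, hle⟩ := Littlestone.exists_ldim_compose_le G hH <;>
    refine ⟨D, hD, hle.trans ?_⟩
  · gcongr
    exact hk.trans (le_mul_of_one_le_left (by positivity) hpow)
  · gcongr
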